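/- Let $d\ge 1$, $k\in\{1,\dots,d\}$, let $F_i\in\mathbb{R}^{M_i\times r}$ ($1\le i\le d$) be fixed matrices and let $R_i\in\mathbb{R}^{M_i\times r'}$, $r'\ge 1$, be random matrices such that all entries of all the $R_i$ are independent and have the same law, which is either the signed Bernoulli law ($\pm1$ with probability $1/2$ each) or the standard Gaussian law. Let $$B_k=\prod_{i\ne k}R_i^TF_i\in\mathbb{R}^{r'\times r},\qquad B_k^{ALS}=\prod_{i\ne k}F_i^TF_i\in\mathbb{R}^{r\times r}$$ (Hadamard products) be the randomized and the standard ALS matrices. For a real random variable $X$ put $\|X\|_{\psi_2}=\sup_{p\ge1}p^{-1/2}(\mathbb{E}|X|^p)^{1/p}\in[0,\infty]$, for a random vector $X\in\mathbb{R}^n$ put $\|X\|_{\psi_2}=\sup_{\|x\|_2=1}\|\langle X,x\rangle\|_{\psi_2}$, and call $X$ sub-Gaussian if this is finite. Let $\|\cdot\|$ be the spectral norm and let $\kappa(A)=\sigma_{\max}(A)/\sigma_{\min}(A)$, where $\sigma_{\max}$ and $\sigma_{\min}$ are the largest and the smallest nonzero singular value. (1) The second-moment matrix of every row of $B_k$ exists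 and equals $B_k^{ALS}$: $\mathbb{E}\left[B_k(\hat l,l)B_k(\hat l,l')\right]=B_k^{ALS}(l,l')$ for all $\hat l,l,l'$. (2) If the entries are signed Bernoulli, then the rows of $B_k$ are sub-Gaussian. (3) There are functions $C,c:\mathbb{R}^2\to(0,\infty)$, not depending on any of the data above, with the following property. Suppose that $B_k^{ALS}$ is positive definite and that the rows of $B_k$ are sub-Gaussian, and put $C=C(K,L)$ and $c=c(K,L)$ with $K=\max_{\hat l}\|B_k(\hat l,:)\|_{\psi_2}$ and $L=\|(B_k^{ALS})^{-1/2}\|$. Then for every $t\ge0$ with $C\sqrt{r/r'}+t/\sqrt{r'}<1$, with probability at least $1-2\exp(-ct^2)$, the matrix $B_k$ has rank $r$ and $$\kappa(B_k)\le\frac{1+C\sqrt{r/r'}+t/\sqrt{r'}}{1-C\sqrt{r/r'}-t/\sqrt{r'}}\;\kappa\left((B_k^{ALS})^{1/2}\right).$$ -/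

import Mathlib

open MeasureTheory ProbabilityTheory
open scoped ENNReal Matrix

noncomputable section

namespace RandALS

/-- The randomized ALS matrix in direction `k`: the Hadamard product over `i ≠ k` of the matrices
`R_iᵀ F_i`. The column `F i · l` is the factor in direction `i` of the `l`-th rank-one term. -/
def randB {d : ℕ} (k : Fin d) {M : Fin d → ℕ} {r r' : ℕ}
    (F : ∀ i, Matrix (Fin (M i)) (Fin r) ℝ) (R : ∀ i, Matrix (Fin (M i)) (Fin r') ℝ) :
    Matrix (Fin r') (Fin r) ℝ :=
  fun a l => ∏ i ∈ Finset.univ.erase k, ((R i)ᵀ * F i) a l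

/-- The standard ALS matrix in direction `k`: the Hadamard product over `i ≠ k` of the Gram
matrices `F_iᵀ F_i`. -/
def alsB {d : ℕ} (k : Fin d) {M : Fin d → ℕ} {r : ℕ}
    (F : ∀ i, Matrix (Fin (M i)) (Fin r) ℝ) : Matrix (Fin r) (Fin r) ℝ :=
  fun l l' => ∏ i ∈ Finset.univ.erase k, ((F i)ᵀ * F i) l l'

/-- Largest singular value (singular values are listed in decreasing order). -/
def sigmaMax {m n : ℕ} (A : Matrix (Fin m) (Fin n) ℝ) : ℝ :=
  (Matrix.toEuclideanLin A).singularValues 0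

/-- Smallest nonzero singular value (a matrix has exactly `A.rank` nonzero singular values);
it is `0` for the zero matrix. -/
def sigmaMin {m n : ℕ} (A : Matrix (Fin m) (Fin n) ℝ) : ℝ :=
  (Matrix.toEuclideanLin A).singularValues (A.rank - 1)

/-- Condition number. -/
def cond {m n : ℕ} (A : Matrix (Fin m) (Fin n) ℝ) : ℝ := sigmaMax A / sigmaMin A

section
open scoped MatrixOrder Matrix.Norms.L2Operator

/-- The positive semidefinite square root of a positive semidefinite matrix. -/
def psdSqrt {n : ℕ} (A : Matrix (Fin n) (Fin n) ℝ) : Matrix (Fin n) (Fin n) ℝ := CFC.sqrt A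

/-- The spectral norm. -/
def specNorm {n : ℕ} (A : Matrix (Fin n) (Fin n) ℝ) : ℝ := ‖A‖

end

/-- The law giving mass `1/2` to each of `-1` and `1`. -/
def signedBernoulli : Measure ℝ :=
  (2⁻¹ : ℝ≥0∞) • Measure.dirac (-1) + (2⁻¹ : ℝ≥0∞) • Measure.dirac 1

/-- The sub-Gaussian norm `sup_{p ≥ 1} (E |X|^p)^{1/p} / √p` of a real random variable, with value
`∞` exactly when `X` is not sub-Gaussian. -/
def psi2 {Ω : Type*} [MeasurableSpace Ω] (μ : Measure Ω) (X : Ω → ℝ) : ℝ≥0∞ :=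
  ⨆ (p : ℝ) (_ : 1 ≤ p), eLpNorm X (ENNReal.ofReal p) μ / ENNReal.ofReal (Real.sqrt p)

/-- The sub-Gaussian norm of a random vector: the supremum over the Euclidean unit sphere of the
sub-Gaussian norms of its one-dimensional marginals. -/
def psi2Vec {Ω : Type*} [MeasurableSpace Ω] (μ : Measure Ω) {n : ℕ} (X : Ω → Fin n → ℝ) : ℝ≥0∞ :=
  ⨆ (x : EuclideanSpace ℝ (Fin n)) (_ : ‖x‖ = 1), psi2 μ (fun ω => ∑ j, X ω j * x j)

/-- The largest sub-Gaussian norm of a row of a random matrix. -/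
def rowPsi2 {Ω : Type*} [MeasurableSpace Ω] (μ : Measure Ω) {m n : ℕ}
    (A : Ω → Matrix (Fin m) (Fin n) ℝ) : ℝ≥0∞ :=
  ⨆ a : Fin m, psi2Vec μ (fun ω => A ω a)

/-- All entries of all the random matrices `R i` are independent random variables of law `ν`. -/
structure IsIIDEntries {Ω : Type*} [MeasurableSpace Ω] (μ : Measure Ω) (ν : Measure ℝ)
    {d : ℕ} {M : Fin d → ℕ} {r' : ℕ} (R : Ω → ∀ i, Matrix (Fin (M i)) (Fin r') ℝ) : Prop where
  measurable : ∀ i j a, Measurable (fun ω => R ω i j a)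
  law : ∀ i j a, μ.map (fun ω => R ω i j a) = ν
  indep : iIndepFun
    (fun (q : Σ i : Fin d, Fin (M i) × Fin r') (ω : Ω) => R ω q.1 q.2.1 q.2.2) μ

end RandALS

end

namespace RandALS

/-! The second moments factor over the directions `i ≠ k` by independence, and within one direction
the entries are orthonormal in L², which leaves the Gram matrix. Bounded entries have bounded, hence
sub-Gaussian, rows.

The condition number bound is whitening followed by a net argument. Let `S` be the square root of
the ALS matrix `Aᴬᴸˢ`. For a unit vector `y`, every row of `B` paired with `S⁻¹ y` has second moment
1 and sub-Gaussian norm at most `K L`, and the rows are independent. Bernstein's inequality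
(`measure_abs_sum_sq_sub_ge_le`) therefore makes `‖B S⁻¹ y‖² / r'` close to 1. A union bound over a
`1/2`-net with at most `5 ^ r` points costs a factor that `C` is chosen to absorb, and
`abs_sq_norm_sub_le_of_net` passes from the net to all vectors at the price of a factor 32.

Thus `‖B v‖² / r'` and `‖S v‖²` agree up to a relative error `δ = C√(r/r') + t/√r' < 1`. Testing
this on singular vectors of `B` compares the extreme singular values of `B` and `S`
(`rank_and_cond_le_of_abs_le`). -/

/-! ### Nets on the sphere and quadratic forms -/

/-- A `1/2`-separated subset of the sphere of largest cardinality is a net, since an uncovered point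
could be added to it. Doubling makes the set 1-separated in the ball of radius 2, where a volume
count gives the bound `5 ^ dim`. -/
theorem exists_half_net_unitSphere (E : Type*) [NormedAddCommGroup E] [NormedSpace ℝ E]
    [FiniteDimensional ℝ E] :
    ∃ S : Finset E, (∀ y ∈ S, ‖y‖ = 1) ∧ S.card ≤ 5 ^ Module.finrank ℝ E ∧
      ∀ x : E, ‖x‖ = 1 → ∃ y ∈ S, ‖x - y‖ < 1 / 2 := by
  classical
  let P : Finset E → Prop := fun S =>
    (∀ y ∈ S, ‖y‖ = 1) ∧ ∀ c ∈ S, ∀ d ∈ S, c ≠ d → 1 / 2 ≤ ‖c - d‖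
  have hcard : ∀ S, P S → S.card ≤ 5 ^ Module.finrank ℝ E := by
    intro S hS
    have hinj : Function.Injective (fun x : E => (2 : ℝ) • x) :=
      smul_right_injective E two_ne_zero
    rw [← Finset.card_image_of_injective S hinj]
    apply Besicovitch.card_le_of_separated
    · intro c hc
      obtain ⟨y, hy, rfl⟩ := Finset.mem_image.1 hc
      simp [norm_smul, hS.1 y hy]
    · intro c hc d hd hcd
      obtain ⟨y, hy, rfl⟩ := Finset.mem_image.1 hc
      obtain ⟨z, hz, rfl⟩ := Finset.mem_image.1 hd
      have hyz : y ≠ z := fun h => hcd (by rw [h])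
      have := hS.2 y hy z hz hyz
      rw [← smul_sub, norm_smul]
      norm_num
      linarith
  let Q : ℕ → Prop := fun n => ∃ S, P S ∧ S.card = n
  have hQ0 : Q 0 := ⟨∅, ⟨by simp, by simp⟩, by simp⟩
  obtain ⟨S, hS, hSc⟩ := Nat.findGreatest_spec (P := Q) (Nat.zero_le (5 ^ Module.finrank ℝ E)) hQ0
  refine ⟨S, hS.1, hcard S hS, fun x hx => ?_⟩
  by_contra! hfar
  have hxS : x ∉ S := fun h => by
    have := hfar x h
    norm_num at this
  have hP : P (insert x S) := by
    refine ⟨?_, ?_⟩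
    · simpa [hx] using hS.1
    · intro c hc d hd hcd
      rcases Finset.mem_insert.1 hc with rfl | hc' <;> rcases Finset.mem_insert.1 hd with rfl | hd'
      · exact absurd rfl hcd
      · exact hfar d hd'
      · rw [norm_sub_rev]; exact hfar c hc'
      · exact hS.2 c hc' d hd' hcd
  have h1 : (insert x S).card = S.card + 1 := Finset.card_insert_of_notMem hxS
  have h2 := Nat.le_findGreatest (P := Q) (hcard _ hP) ⟨_, hP, rfl⟩
  omega

/-- A map that is almost an isometry on a `1/2`-net of the sphere is almost an isometry. -/
theorem abs_sq_norm_sub_le_of_net {E F : Type*} [NormedAddCommGroup E] [InnerProductSpace ℝ E]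
    [FiniteDimensional ℝ E] [NormedAddCommGroup F] [InnerProductSpace ℝ F]
    (A : E →ₗ[ℝ] F) (c η : ℝ) (S : Set E) (hS1 : ∀ y ∈ S, ‖y‖ = 1)
    (hS : ∀ x : E, ‖x‖ = 1 → ∃ y ∈ S, ‖x - y‖ < 1 / 2)
    (hη : ∀ y ∈ S, |c * ‖A y‖ ^ 2 - 1| ≤ η) (x : E) :
    |c * ‖A x‖ ^ 2 - ‖x‖ ^ 2| ≤ 32 * η * ‖x‖ ^ 2 := by
  rcases eq_or_ne x 0 with rfl | hx0
  · simp
  set q : E → ℝ := fun x => c * ‖A x‖ ^ 2 - ‖x‖ ^ 2 with hq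
  have hqs : ∀ (a : ℝ) x, q (a • x) = a ^ 2 * q x := by
    intro a x
    simp only [hq, map_smul, norm_smul, mul_pow, Real.norm_eq_abs, sq_abs]
    ring
  have hcont : Continuous q := by
    have : Continuous A := A.continuous_of_finiteDimensional
    fun_prop
  have hnx : ‖(‖x‖⁻¹ : ℝ) • x‖ = 1 := by
    rw [norm_smul, norm_inv, norm_norm, inv_mul_cancel₀ (norm_ne_zero_iff.2 hx0)]
  obtain ⟨x₀, hx₀, hmax⟩ := (isCompact_sphere (0 : E) 1).exists_isMaxOn
    ⟨(‖x‖⁻¹ : ℝ) • x, by simpa using hnx⟩ hcont.abs.continuousOn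
  have hx₀ : ‖x₀‖ = 1 := by simpa using hx₀
  set m := |q x₀| with hm
  have hall : ∀ z, |q z| ≤ m * ‖z‖ ^ 2 := by
    intro z
    rcases eq_or_ne z 0 with rfl | hz
    · simp [hq]
    have hz' : ‖z‖ ≠ 0 := norm_ne_zero_iff.2 hz
    have h1 : ‖(‖z‖⁻¹ : ℝ) • z‖ = 1 := by
      rw [norm_smul, norm_inv, norm_norm, inv_mul_cancel₀ hz']
    have h2 : z = ‖z‖ • ((‖z‖⁻¹ : ℝ) • z) := by
      rw [smul_smul, mul_inv_cancel₀ hz', one_smul]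
    have h3 : |q ((‖z‖⁻¹ : ℝ) • z)| ≤ m := hmax (by simpa using h1)
    calc |q z| = |q (‖z‖ • ((‖z‖⁻¹ : ℝ) • z))| := by rw [← h2]
      _ = ‖z‖ ^ 2 * |q ((‖z‖⁻¹ : ℝ) • z)| := by rw [hqs, abs_mul, abs_of_nonneg (sq_nonneg _)]
      _ ≤ m * ‖z‖ ^ 2 := by rw [mul_comm]; gcongr
  obtain ⟨y, hyS, hxy⟩ := hS x₀ hx₀
  have hy := hS1 y hyS
  set u := x₀ + y with hu
  set v := x₀ - y with hv
  have hpar : ‖u‖ ^ 2 + ‖v‖ ^ 2 = 4 := by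
    have := parallelogram_law_with_norm ℝ x₀ y
    rw [hx₀, hy] at this
    nlinarith
  -- The left side is the polar form of `q` at `(u, v)`, equivalently at `(u / 2, 2 v)`. This
  -- rescaling balances the long vector `u` against the short `v`: with `‖v‖² ≤ 1/4` the bound
  -- becomes `31/32 * m`, strictly below `m`.
  have hdiff : q x₀ - q y
      = (q ((1 / 2 : ℝ) • u + (2 : ℝ) • v) - q ((1 / 2 : ℝ) • u - (2 : ℝ) • v)) / 4 := by
    simp only [hq, hu, hv, map_add, map_sub, map_smul]
    simp only [← real_inner_self_eq_norm_sq, inner_add_left, inner_sub_left, inner_add_right,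
      inner_sub_right, inner_smul_left, inner_smul_right, real_inner_comm x₀ y,
      real_inner_comm (A x₀) (A y), conj_trivial]
    ring
  have hpar2 : ‖(1 / 2 : ℝ) • u + (2 : ℝ) • v‖ ^ 2 + ‖(1 / 2 : ℝ) • u - (2 : ℝ) • v‖ ^ 2
      = 2 * (‖u‖ ^ 2 / 4 + 4 * ‖v‖ ^ 2) := by
    have := parallelogram_law_with_norm ℝ ((1 / 2 : ℝ) • u) ((2 : ℝ) • v)
    simp only [norm_smul] at this
    norm_num at this
    norm_num
    nlinarith
  have hv2 : ‖v‖ ^ 2 ≤ 1 / 4 := by nlinarith [norm_nonneg v]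
  have hb1 := hall ((1 / 2 : ℝ) • u + (2 : ℝ) • v)
  have hb2 := hall ((1 / 2 : ℝ) • u - (2 : ℝ) • v)
  have hm0 : 0 ≤ m := abs_nonneg _
  have hqd : |q x₀ - q y| ≤ 31 / 32 * m := by
    rw [hdiff, abs_div, abs_of_pos (by norm_num : (0 : ℝ) < 4)]
    have h := abs_sub (q ((1 / 2 : ℝ) • u + (2 : ℝ) • v)) (q ((1 / 2 : ℝ) • u - (2 : ℝ) • v))
    have : m * ‖(1 / 2 : ℝ) • u + (2 : ℝ) • v‖ ^ 2 + m * ‖(1 / 2 : ℝ) • u - (2 : ℝ) • v‖ ^ 2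
        ≤ m * (31 / 8) := by
      rw [← mul_add, hpar2]
      gcongr
      linarith
    linarith
  have hqy : |q y| ≤ η := by simpa [hq, hy] using hη y hyS
  have hmη : m ≤ 32 * η := by
    have : |q x₀| ≤ |q x₀ - q y| + |q y| := by
      simpa using abs_add_le (q x₀ - q y) (q y)
    linarith
  exact (hall x).trans (by gcongr)

/-! ### Exponential moments and Bernstein's inequality -/

section Tail

variable {Ω : Type*} [MeasurableSpace Ω] {μ : Measure Ω}

theorem lintegral_sq_pow_le_of_psi2_le {Z : Ω → ℝ} {K : ℝ} (hK : 0 ≤ K)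
    (hZ : psi2 μ Z ≤ ENNReal.ofReal K) {m : ℕ} (hm : 1 ≤ m) :
    ∫⁻ ω, ENNReal.ofReal ((Z ω ^ 2) ^ m) ∂μ ≤ ENNReal.ofReal ((K ^ 2 * (2 * m)) ^ m) := by
  have hm' : (1 : ℝ) ≤ m := by exact_mod_cast hm
  have hp : (1 : ℝ) ≤ 2 * m := by linarith
  have h1 : eLpNorm Z (ENNReal.ofReal (2 * m)) μ / ENNReal.ofReal √(2 * m) ≤ ENNReal.ofReal K :=
    (le_iSup₂_of_le (f := fun (p : ℝ) (_ : 1 ≤ p) =>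
      eLpNorm Z (ENNReal.ofReal p) μ / ENNReal.ofReal (Real.sqrt p)) (2 * m : ℝ) hp le_rfl).trans hZ
  have hsq : 0 < √(2 * m : ℝ) := Real.sqrt_pos.2 (by linarith)
  rw [ENNReal.div_le_iff (by simpa using hsq) ENNReal.ofReal_ne_top,
    ← ENNReal.ofReal_mul hK] at h1
  have h2 : eLpNorm Z (ENNReal.ofReal (2 * m)) μ ^ (2 * m : ℝ)
      = ∫⁻ ω, ENNReal.ofReal ((Z ω ^ 2) ^ m) ∂μ := by
    have h0 : ENNReal.ofReal (2 * m) ≠ 0 := by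
      rw [Ne, ENNReal.ofReal_eq_zero]; linarith
    rw [eLpNorm_eq_lintegral_rpow_enorm_toReal h0 ENNReal.ofReal_ne_top,
      ENNReal.toReal_ofReal (by linarith), ← ENNReal.rpow_mul, one_div,
      inv_mul_cancel₀ (by linarith), ENNReal.rpow_one]
    refine lintegral_congr fun ω => ?_
    rw [Real.enorm_eq_ofReal_abs, ENNReal.ofReal_rpow_of_nonneg (abs_nonneg _) (by linarith)]
    congr 1
    rw [← pow_mul, show (2 * m : ℝ) = ((2 * m : ℕ) : ℝ) by push_cast; ring, Real.rpow_natCast,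
      pow_mul, sq_abs, pow_mul]
  rw [← h2]
  calc eLpNorm Z (ENNReal.ofReal (2 * m)) μ ^ (2 * m : ℝ)
      ≤ ENNReal.ofReal (K * √(2 * m)) ^ (2 * m : ℝ) := by gcongr
    _ = ENNReal.ofReal ((K ^ 2 * (2 * m)) ^ m) := by
      rw [ENNReal.ofReal_rpow_of_nonneg (by positivity) (by linarith)]
      congr 1
      rw [show (2 * m : ℝ) = ((2 * m : ℕ) : ℝ) by push_cast; ring, Real.rpow_natCast,
        pow_mul, mul_pow, Real.sq_sqrt (by positivity)]

/-- Expand the exponential and bound the moment of order `2m` by `(2 m K²) ^ m`. Since `m ^ m ≤ m! e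
^ m`, the exponent `1 / (4 e K²)` makes the `m`-th term at most `2 ^ (-m)`. -/
theorem lintegral_exp_mul_sq_le_two [IsProbabilityMeasure μ] {Z : Ω → ℝ} (hZm : Measurable Z)
    {K : ℝ} (hK : 0 < K) (hZ : psi2 μ Z ≤ ENNReal.ofReal K) :
    ∫⁻ ω, ENNReal.ofReal (Real.exp (1 / (4 * Real.exp 1 * K ^ 2) * Z ω ^ 2)) ∂μ ≤ 2 := by
  set s : ℝ := 1 / (4 * Real.exp 1 * K ^ 2) with hs
  have hs0 : 0 < s := by positivity
  have hexp : ∀ ω, ENNReal.ofReal (Real.exp (s * Z ω ^ 2))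
      = ∑' m : ℕ, ENNReal.ofReal (s ^ m / m.factorial) * ENNReal.ofReal ((Z ω ^ 2) ^ m) := by
    intro ω
    rw [Real.exp_eq_exp_ℝ, NormedSpace.exp_eq_tsum_div,
      ENNReal.ofReal_tsum_of_nonneg (fun m => by positivity)
        (Real.summable_pow_div_factorial (s * Z ω ^ 2))]
    refine tsum_congr fun m => ?_
    rw [← ENNReal.ofReal_mul (by positivity), mul_pow]
    congr 1
    ring
  have hterm : ∀ m : ℕ, ∫⁻ ω, ENNReal.ofReal (s ^ m / m.factorial) *
      ENNReal.ofReal ((Z ω ^ 2) ^ m) ∂μ ≤ ENNReal.ofReal ((1 / 2 : ℝ) ^ m) := by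
    intro m
    rw [lintegral_const_mul _ (by fun_prop)]
    rcases Nat.eq_zero_or_pos m with rfl | hm
    · simp
    have h1 := lintegral_sq_pow_le_of_psi2_le hK.le hZ hm
    refine (mul_le_mul_right h1 _).trans ?_
    rw [← ENNReal.ofReal_mul (by positivity)]
    apply ENNReal.ofReal_le_ofReal
    have h2 := Real.pow_div_factorial_le_exp (m : ℝ) (by positivity) m
    have h3 : s ^ m / m.factorial * (K ^ 2 * (2 * m)) ^ m
        = (1 / 2 : ℝ) ^ m * ((m : ℝ) ^ m / m.factorial * (Real.exp 1 ^ m)⁻¹) := by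
      rw [div_mul_eq_mul_div, ← mul_pow, show s * (K ^ 2 * (2 * m)) = 1 / 2 * (m * (Real.exp 1)⁻¹) by
        rw [hs]; field_simp; ring]
      rw [mul_pow, mul_pow, inv_pow]
      ring
    rw [h3]
    have h4 : (m : ℝ) ^ m / m.factorial * (Real.exp 1 ^ m)⁻¹ ≤ 1 := by
      rw [← Real.exp_nat_mul, mul_one, ← div_eq_mul_inv, div_le_one (Real.exp_pos _)]
      exact h2
    have : (0 : ℝ) ≤ (1 / 2) ^ m := by positivity
    nlinarith
  calc ∫⁻ ω, ENNReal.ofReal (Real.exp (s * Z ω ^ 2)) ∂μ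
      = ∑' m : ℕ, ∫⁻ ω, ENNReal.ofReal (s ^ m / m.factorial) *
          ENNReal.ofReal ((Z ω ^ 2) ^ m) ∂μ := by
        simp_rw [hexp]
        exact lintegral_tsum fun m => by fun_prop
    _ ≤ ∑' m : ℕ, ENNReal.ofReal ((1 / 2 : ℝ) ^ m) := ENNReal.tsum_le_tsum hterm
    _ = 2 := by
        rw [← ENNReal.ofReal_tsum_of_nonneg (fun m => by positivity) summable_geometric_two,
          tsum_geometric_two]
        simp

/-- The Taylor remainder is at most `(l y)² exp |l y|`. Half of the exponent `s |y|` absorbs `y²`,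
the other half absorbs `exp |l y|`. The linear term is kept exact because it integrates to zero for
a centred variable. -/
theorem exp_le_one_add_add_of_abs_le {s l y : ℝ} (hs : 0 < s) (hl : |l| ≤ s / 2) :
    Real.exp (l * y) ≤ 1 + l * y + l ^ 2 * (8 / s ^ 2) * Real.exp (s * |y|) := by
  have h1 : Real.exp (l * y) - (1 + l * y) ≤ |l * y| ^ 2 * Real.exp |l * y| := by
    have := Complex.norm_exp_sub_sum_le_norm_mul_exp (((l * y : ℝ)) : ℂ) 2
    simp only [Finset.sum_range_succ, Finset.sum_range_zero, Nat.factorial, pow_zero, pow_one,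
      zero_add, Nat.cast_one, div_one, mul_one] at this
    rw [← Complex.ofReal_exp, ← Complex.ofReal_one, ← Complex.ofReal_add, ← Complex.ofReal_sub,
      Complex.norm_real, Complex.norm_real] at this
    exact (le_abs_self _).trans this
  have h2 : |l * y| ^ 2 ≤ l ^ 2 * (8 / s ^ 2) * Real.exp (s / 2 * |y|) := by
    have h := Real.pow_div_factorial_le_exp (s / 2 * |y|) (by positivity) 2
    have h' : y ^ 2 ≤ 8 / s ^ 2 * Real.exp (s / 2 * |y|) := by
      rw [div_mul_eq_mul_div, le_div_iff₀ (by positivity)]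
      simp only [Nat.factorial, mul_pow, sq_abs] at h
      norm_num at h
      nlinarith
    rw [sq_abs, mul_pow, mul_assoc]
    gcongr
  have h3 : Real.exp |l * y| ≤ Real.exp (s / 2 * |y|) := by
    rw [abs_mul]
    gcongr
  have h4 : Real.exp (s * |y|) = Real.exp (s / 2 * |y|) * Real.exp (s / 2 * |y|) := by
    rw [← Real.exp_add]; congr 1; ring
  have h5 : |l * y| ^ 2 * Real.exp |l * y|
      ≤ l ^ 2 * (8 / s ^ 2) * Real.exp (s / 2 * |y|) * Real.exp (s / 2 * |y|) := by
    gcongr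
  rw [h4]
  linarith

/-- The centred square of a sub-Gaussian variable of unit second moment is sub-exponential. -/
theorem mgf_sq_sub_one_le [IsProbabilityMeasure μ] {Z : Ω → ℝ} (hZm : Measurable Z)
    {s : ℝ} (hs : 0 < s) (hZ : ∫⁻ ω, ENNReal.ofReal (Real.exp (s * Z ω ^ 2)) ∂μ ≤ 2)
    (hint : Integrable (fun ω => Z ω ^ 2) μ) (hone : ∫ ω, Z ω ^ 2 ∂μ = 1)
    {l : ℝ} (hl : |l| ≤ s / 2) :
    Integrable (fun ω => Real.exp (l * (Z ω ^ 2 - 1))) μ ∧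
      mgf (fun ω => Z ω ^ 2 - 1) μ l ≤ Real.exp (16 * Real.exp s / s ^ 2 * l ^ 2) := by
  have hI : Integrable (fun ω => Real.exp (s * Z ω ^ 2)) μ := by
    refine ⟨by fun_prop, ?_⟩
    rw [hasFiniteIntegral_iff_ofReal (Filter.Eventually.of_forall fun _ => (Real.exp_pos _).le)]
    exact hZ.trans_lt (by simp)
  have hI2 : ∫ ω, Real.exp (s * Z ω ^ 2) ∂μ ≤ 2 := by
    rw [integral_eq_lintegral_of_nonneg_ae
      (Filter.Eventually.of_forall fun _ => (Real.exp_pos _).le) (by fun_prop)]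
    exact ENNReal.toReal_le_of_le_ofReal (by norm_num) (by simpa using hZ)
  have habs : ∀ ω, Real.exp (s * |Z ω ^ 2 - 1|) ≤ Real.exp s * Real.exp (s * Z ω ^ 2) := by
    intro ω
    rw [← Real.exp_add]
    apply Real.exp_le_exp.2
    have : |Z ω ^ 2 - 1| ≤ 1 + Z ω ^ 2 := by
      rw [abs_le]; constructor <;> nlinarith [sq_nonneg (Z ω)]
    nlinarith
  have hint' : Integrable (fun ω => Real.exp (l * (Z ω ^ 2 - 1))) μ := by
    refine (hI.const_mul (Real.exp s)).mono' (by fun_prop) (Filter.Eventually.of_forall fun ω => ?_)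
    rw [Real.norm_eq_abs, abs_of_pos (Real.exp_pos _)]
    refine le_trans (Real.exp_le_exp.2 ?_) (habs ω)
    refine (le_abs_self _).trans ?_
    rw [abs_mul]
    gcongr
    linarith
  refine ⟨hint', ?_⟩
  have hpt : ∀ ω, Real.exp (l * (Z ω ^ 2 - 1))
      ≤ 1 + l * (Z ω ^ 2 - 1) + l ^ 2 * (8 / s ^ 2) * (Real.exp s * Real.exp (s * Z ω ^ 2)) :=
    fun ω => (exp_le_one_add_add_of_abs_le hs hl).trans (by gcongr; exact habs ω)
  have hi0 : Integrable (fun ω => l * (Z ω ^ 2 - 1)) μ :=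
    (hint.sub (integrable_const _)).const_mul _
  have hi1 : Integrable (fun ω => 1 + l * (Z ω ^ 2 - 1)) μ := (integrable_const _).add hi0
  have hi2 : Integrable (fun ω => l ^ 2 * (8 / s ^ 2) * (Real.exp s * Real.exp (s * Z ω ^ 2))) μ :=
    (hI.const_mul _).const_mul _
  calc mgf (fun ω => Z ω ^ 2 - 1) μ l
      ≤ ∫ ω, (1 + l * (Z ω ^ 2 - 1)
          + l ^ 2 * (8 / s ^ 2) * (Real.exp s * Real.exp (s * Z ω ^ 2))) ∂μ :=
        integral_mono hint' (hi1.add hi2) hpt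
    _ = 1 + l ^ 2 * (8 / s ^ 2) * (Real.exp s * ∫ ω, Real.exp (s * Z ω ^ 2) ∂μ) := by
        rw [integral_add hi1 hi2, integral_add (integrable_const _) hi0, integral_const_mul,
          integral_sub hint (integrable_const _), hone, integral_const_mul, integral_const_mul]
        simp
    _ ≤ 1 + l ^ 2 * (8 / s ^ 2) * (Real.exp s * 2) := by gcongr
    _ = 16 * Real.exp s / s ^ 2 * l ^ 2 + 1 := by ring
    _ ≤ _ := Real.add_one_le_exp _

/-- Bernstein's inequality for sums of squares of sub-Gaussian variables of unit variance. -/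
theorem measure_abs_sum_sq_sub_ge_le [IsProbabilityMeasure μ] {N : ℕ} (hN : 0 < N)
    {Z : Fin N → Ω → ℝ}
    (hZm : ∀ a, Measurable (Z a)) (hindep : iIndepFun Z μ)
    {s : ℝ} (hs : 0 < s)
    (hZ : ∀ a, ∫⁻ ω, ENNReal.ofReal (Real.exp (s * Z a ω ^ 2)) ∂μ ≤ 2)
    (hint : ∀ a, Integrable (fun ω => Z a ω ^ 2) μ) (hone : ∀ a, ∫ ω, Z a ω ^ 2 ∂μ = 1)
    {ε : ℝ} (hε0 : 0 ≤ ε) (hε1 : ε ≤ 1) :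
    μ.real {ω | ε ≤ |(N : ℝ)⁻¹ * ∑ a, Z a ω ^ 2 - 1|}
      ≤ 2 * Real.exp (-(s ^ 2 / (64 * Real.exp s)) * (N * ε ^ 2)) := by
  set Y : Fin N → Ω → ℝ := fun a ω => Z a ω ^ 2 - 1 with hY
  have hYm : ∀ a, Measurable (Y a) := fun a => by fun_prop
  have hYi : iIndepFun Y μ := hindep.comp (fun _ x => x ^ 2 - 1) (fun _ => by fun_prop)
  set D := 16 * Real.exp s / s ^ 2 with hD
  have hD0 : 0 < D := by positivity
  -- `l = α ε` minimises the Chernoff exponent `-l ε + D l²`, as `α = 1 / (2 D)`. The assumption `ε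
  -- ≤ 1` keeps it in the range `|l| ≤ s / 2` of the moment bound.
  set α := s ^ 2 / (32 * Real.exp s) with hα
  have hα0 : 0 < α := by positivity
  have hDα : D * α = 1 / 2 := by
    rw [hD, hα]; field_simp; norm_num
  have hαs : α ≤ s / 2 := by
    rw [hα, div_le_div_iff₀ (by positivity) (by norm_num)]
    nlinarith [Real.add_one_le_exp s]
  have hle : |α * ε| ≤ s / 2 := by
    rw [abs_of_nonneg (by positivity)]
    nlinarith
  have hle' : |-(α * ε)| ≤ s / 2 := by rwa [abs_neg]
  have hmgf : ∀ l : ℝ, |l| ≤ s / 2 →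
      Integrable (fun ω => Real.exp (l * (∑ a, Y a) ω)) μ ∧
      mgf (∑ a, Y a) μ l ≤ Real.exp (N * (D * l ^ 2)) := by
    intro l hl
    have h := fun a => mgf_sq_sub_one_le (hZm a) hs (hZ a) (hint a) (hone a) hl
    refine ⟨hYi.integrable_exp_mul_sum hYm fun a _ => (h a).1, ?_⟩
    rw [hYi.mgf_sum hYm]
    calc ∏ a, mgf (Y a) μ l ≤ ∏ _a : Fin N, Real.exp (D * l ^ 2) :=
          Finset.prod_le_prod (fun _ _ => mgf_nonneg) fun a _ => (h a).2
      _ = _ := by simp [← Real.exp_nat_mul]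
  have hexpo : -(α * ε) * (N * ε) + N * (D * (α * ε) ^ 2)
      = -(s ^ 2 / (64 * Real.exp s)) * (N * ε ^ 2) := by
    have : s ^ 2 / (64 * Real.exp s) = α / 2 := by rw [hα]; field_simp; norm_num
    rw [this]
    linear_combination N * ε ^ 2 * α * hDα
  have hup : μ.real {ω | N * ε ≤ (∑ a, Y a) ω}
      ≤ Real.exp (-(s ^ 2 / (64 * Real.exp s)) * (N * ε ^ 2)) := by
    obtain ⟨h1, h2⟩ := hmgf _ hle
    refine (measure_ge_le_exp_mul_mgf _ (by positivity) h1).trans ?_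
    rw [← hexpo, Real.exp_add]
    gcongr
  have hdown : μ.real {ω | (∑ a, Y a) ω ≤ -(N * ε)}
      ≤ Real.exp (-(s ^ 2 / (64 * Real.exp s)) * (N * ε ^ 2)) := by
    obtain ⟨h1, h2⟩ := hmgf _ hle'
    refine (measure_le_le_exp_mul_mgf _ (by simp; positivity) h1).trans ?_
    rw [neg_sq] at h2
    rw [← hexpo, Real.exp_add]
    refine mul_le_mul (le_of_eq ?_) h2 mgf_nonneg (Real.exp_pos _).le
    congr 1; ring
  have hsub : {ω | ε ≤ |(N : ℝ)⁻¹ * ∑ a, Z a ω ^ 2 - 1|}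
      ⊆ {ω | N * ε ≤ (∑ a, Y a) ω} ∪ {ω | (∑ a, Y a) ω ≤ -(N * ε)} := by
    intro ω hω
    have hN' : (0 : ℝ) < N := by exact_mod_cast hN
    have hsum : (∑ a, Y a) ω = N * ((N : ℝ)⁻¹ * ∑ a, Z a ω ^ 2 - 1) := by
      simp only [hY, Finset.sum_apply, Finset.sum_sub_distrib]
      field_simp
      simp
    simp only [Set.mem_union, Set.mem_ofPred_eq] at hω ⊢
    rw [hsum]
    rcases le_abs.1 hω with h | h
    · left; gcongr
    · right; nlinarith
  calc _ ≤ _ := measureReal_mono hsub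
    _ ≤ _ := measureReal_union_le _ _
    _ ≤ _ := by linarith

end Tail

/-! ### Singular values and comparison of condition numbers -/

section SingularValues

variable {E F : Type*} [NormedAddCommGroup E] [InnerProductSpace ℝ E] [FiniteDimensional ℝ E]
  [NormedAddCommGroup F] [InnerProductSpace ℝ F] [FiniteDimensional ℝ F]

theorem exists_norm_map_eq_singularValues (T : E →ₗ[ℝ] F) {i : ℕ}
    (hi : i < Module.finrank ℝ E) : ∃ v : E, ‖v‖ = 1 ∧ ‖T v‖ = T.singularValues i := by
  have hS := T.isSymmetric_adjoint_comp_self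
  set b := hS.eigenvectorBasis rfl with hb
  refine ⟨b ⟨i, hi⟩, b.orthonormal.1 _, ?_⟩
  rw [← sq_eq_sq₀ (norm_nonneg _) (T.singularValues_nonneg i), T.sq_singularValues_of_lt rfl hi,
    ← real_inner_self_eq_norm_sq, ← LinearMap.adjoint_inner_left]
  have := hS.apply_eigenvectorBasis rfl ⟨i, hi⟩
  rw [LinearMap.comp_apply] at this
  rw [hb, this, inner_smul_left, real_inner_self_eq_norm_sq, (hS.eigenvectorBasis rfl).orthonormal.1]
  simp

/-- Parseval for `⟪T* T v, v⟫` in an eigenbasis of `T* T`. Both extremal bounds on `‖T v‖` follow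
from it by monotonicity of the singular values. -/
theorem sq_norm_map_eq_sum (T : E →ₗ[ℝ] F) (v : E) :
    ‖T v‖ ^ 2 = ∑ i : Fin (Module.finrank ℝ E), T.singularValues i ^ 2 *
      inner ℝ (T.isSymmetric_adjoint_comp_self.eigenvectorBasis rfl i) v ^ 2 := by
  have hS := T.isSymmetric_adjoint_comp_self
  rw [← real_inner_self_eq_norm_sq, ← LinearMap.adjoint_inner_left,
    ← (hS.eigenvectorBasis rfl).sum_inner_mul_inner]
  refine Finset.sum_congr rfl fun i _ => ?_
  have h1 : inner ℝ (LinearMap.adjoint T (T v)) (hS.eigenvectorBasis rfl i)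
      = hS.eigenvalues rfl i * inner ℝ (hS.eigenvectorBasis rfl i) v := by
    have h2 := hS v (hS.eigenvectorBasis rfl i)
    rw [LinearMap.comp_apply, hS.apply_eigenvectorBasis, inner_smul_right, real_inner_comm _ v] at h2
    simpa using h2
  rw [h1, T.sq_singularValues_fin rfl]
  ring

theorem sum_sq_inner_eigenvectorBasis (T : E →ₗ[ℝ] F) (v : E) :
    ∑ i, inner ℝ (T.isSymmetric_adjoint_comp_self.eigenvectorBasis rfl i) v ^ 2 = ‖v‖ ^ 2 := by
  simpa using (T.isSymmetric_adjoint_comp_self.eigenvectorBasis rfl).sum_sq_norm_inner_right v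

theorem norm_map_le_singularValues_zero (T : E →ₗ[ℝ] F) (v : E) :
    ‖T v‖ ≤ T.singularValues 0 * ‖v‖ := by
  apply le_of_sq_le_sq _ (mul_nonneg (T.singularValues_nonneg 0) (norm_nonneg v))
  rw [sq_norm_map_eq_sum, mul_pow, ← sum_sq_inner_eigenvectorBasis T, Finset.mul_sum]
  gcongr with i
  · exact T.singularValues_nonneg _
  · exact T.singularValues_antitone (Nat.zero_le _)

theorem singularValues_mul_norm_le (T : E →ₗ[ℝ] F) (v : E) :
    T.singularValues (Module.finrank ℝ E - 1) * ‖v‖ ≤ ‖T v‖ := by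
  apply le_of_sq_le_sq _ (norm_nonneg _)
  rw [sq_norm_map_eq_sum, mul_pow, ← sum_sq_inner_eigenvectorBasis T, Finset.mul_sum]
  gcongr with i
  · exact T.singularValues_nonneg _
  · exact T.singularValues_antitone (by omega)

end SingularValues

theorem rank_eq_of_injective {m n : ℕ} (A : Matrix (Fin m) (Fin n) ℝ)
    (h : Function.Injective (Matrix.toEuclideanLin A)) : A.rank = n := by
  rw [Matrix.rank_eq_finrank_range_toLin A (EuclideanSpace.basisFun _ ℝ).toBasis
    (EuclideanSpace.basisFun _ ℝ).toBasis, ← Matrix.toEuclideanLin_eq_toLin_orthonormal,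
    LinearMap.finrank_range_of_inj h, finrank_euclideanSpace_fin]

/-- If `‖B v‖² / N` and `‖S v‖²` agree up to a relative error `δ < 1`, then `B` has full rank and
its condition number is controlled by that of `S`. -/
theorem rank_and_cond_le_of_abs_le {m n : ℕ} (B : Matrix (Fin m) (Fin n) ℝ)
    (S : Matrix (Fin n) (Fin n) ℝ) (hS : Function.Injective (Matrix.toEuclideanLin S))
    {c δ : ℝ} (hc : 0 < c) (hδ0 : 0 ≤ δ) (hδ : δ < 1)
    (h : ∀ v, |c * ‖Matrix.toEuclideanLin B v‖ ^ 2 - ‖Matrix.toEuclideanLin S v‖ ^ 2|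
      ≤ δ * ‖Matrix.toEuclideanLin S v‖ ^ 2) :
    B.rank = n ∧ cond B ≤ (1 + δ) / (1 - δ) * cond S := by
  have hB : Function.Injective (Matrix.toEuclideanLin B) := by
    rw [injective_iff_map_eq_zero]
    intro v hv
    have h1 := h v
    rw [hv, norm_zero, abs_le] at h1
    have h2 : ‖Matrix.toEuclideanLin S v‖ ^ 2 ≤ 0 := by nlinarith [h1.1]
    have h3 : ‖Matrix.toEuclideanLin S v‖ = 0 := by nlinarith [norm_nonneg (Matrix.toEuclideanLin S v)]
    exact (injective_iff_map_eq_zero _).1 hS v (norm_eq_zero.1 h3)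
  have hrB := rank_eq_of_injective B hB
  have hrS := rank_eq_of_injective S hS
  refine ⟨hrB, ?_⟩
  rw [cond, cond, sigmaMax, sigmaMax, sigmaMin, sigmaMin, hrB, hrS]
  rcases Nat.eq_zero_or_pos n with rfl | hn
  · rw [(Matrix.toEuclideanLin B).singularValues_of_finrank_le (i := 0) (by simp)]
    rw [(Matrix.toEuclideanLin S).singularValues_of_finrank_le (i := 0) (by simp)]
    simp
  have hfr : Module.finrank ℝ (EuclideanSpace ℝ (Fin n)) = n := finrank_euclideanSpace_fin
  -- Vectors realising the extreme singular values of `B` suffice: the hypothesis at `v` bounds the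
  -- largest from above, and at `w` the smallest from below.
  obtain ⟨v, hv1, hv⟩ := exists_norm_map_eq_singularValues (Matrix.toEuclideanLin B) (i := 0)
    (by rw [hfr]; exact hn)
  obtain ⟨w, hw1, hw⟩ := exists_norm_map_eq_singularValues (Matrix.toEuclideanLin B) (i := n - 1)
    (by rw [hfr]; omega)
  have hSv := norm_map_le_singularValues_zero (Matrix.toEuclideanLin S) v
  have hSw := singularValues_mul_norm_le (Matrix.toEuclideanLin S) w
  have hτ : 0 < (Matrix.toEuclideanLin S).singularValues (n - 1) :=
    (LinearMap.injective_iff_forall_lt_finrank_singularValues_pos _).1 hS _ (by rw [hfr]; omega)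
  have hσ : 0 < (Matrix.toEuclideanLin B).singularValues (n - 1) :=
    (LinearMap.injective_iff_forall_lt_finrank_singularValues_pos _).1 hB _ (by rw [hfr]; omega)
  have hv' := (abs_le.1 (h v)).2
  have hw' := (abs_le.1 (h w)).1
  rw [hfr] at hSw
  rw [hv] at hv'
  rw [hw] at hw'
  rw [hv1, mul_one] at hSv
  rw [hw1, mul_one] at hSw
  set p := (Matrix.toEuclideanLin B).singularValues 0
  set q := (Matrix.toEuclideanLin B).singularValues (n - 1)
  set P := (Matrix.toEuclideanLin S).singularValues 0
  set Q := (Matrix.toEuclideanLin S).singularValues (n - 1)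
  have hP0 : 0 ≤ P := (Matrix.toEuclideanLin S).singularValues_nonneg 0
  have hp0 : 0 ≤ p := (Matrix.toEuclideanLin B).singularValues_nonneg 0
  have hd : 0 < 1 - δ := by linarith
  have h1 : c * p ^ 2 ≤ (1 + δ) * P ^ 2 := by
    have : ‖Matrix.toEuclideanLin S v‖ ^ 2 ≤ P ^ 2 := by gcongr
    nlinarith
  have h2 : (1 - δ) * Q ^ 2 ≤ c * q ^ 2 := by
    have : Q ^ 2 ≤ ‖Matrix.toEuclideanLin S w‖ ^ 2 := by gcongr
    nlinarith
  rw [div_mul_div_comm, div_le_div_iff₀ hσ (by positivity)]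
  apply le_of_sq_le_sq _ (by positivity)
  -- The two estimates already give the factor `√((1 + δ) / (1 - δ))`; the spare `1 - δ ≤ 1 + δ`
  -- weakens it to the stated one. The scale `c` cancels.
  have h3 : c * (p * ((1 - δ) * Q)) ^ 2 ≤ c * ((1 + δ) * P * q) ^ 2 := by
    calc c * (p * ((1 - δ) * Q)) ^ 2 = (c * p ^ 2) * ((1 - δ) * ((1 - δ) * Q ^ 2)) := by ring
      _ ≤ ((1 + δ) * P ^ 2) * ((1 + δ) * (c * q ^ 2)) := by
          gcongr
          linarith
      _ = _ := by ring
  exact le_of_mul_le_mul_left h3 hc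

/-! ### Independence of blocks, moments and sub-Gaussian norms -/

section Probability

variable {Ω : Type*} [MeasurableSpace Ω] {μ : Measure Ω}

/-- Disjoint blocks of an independent family are independent. -/
theorem iIndepFun_curry {ι : Type*} {κ : ι → Type*} {β : (i : ι) → κ i → Type*}
    [∀ i j, MeasurableSpace (β i j)] {X : (i : ι) → (j : κ i) → Ω → β i j}
    (hX : ∀ i j, Measurable (X i j))
    (h : iIndepFun (fun (p : (i : ι) × κ i) ω => X p.1 p.2 ω) μ) :
    iIndepFun (fun i ω => (X i · ω)) μ := by
  have := h.isProbabilityMeasure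
  have : ∀ i j, IsProbabilityMeasure (μ.map (X i j)) :=
    fun i j => Measure.isProbabilityMeasure_map (hX i j).aemeasurable
  have hcomp : (MeasurableEquiv.piCurry β) ∘ (fun ω p => X p.1 p.2 ω) = fun ω i j => X i j ω := by
    ext; simp [Sigma.curry]
  have h2 : ∀ i, iIndepFun (X i) μ := fun i =>
    h.precomp (g := fun j : κ i => (⟨i, j⟩ : (i : ι) × κ i)) sigma_mk_injective
  rw [iIndepFun_iff_map_fun_eq_infinitePi_map (by fun_prop)] at h ⊢
  rw [← hcomp, ← Measure.map_map (by fun_prop) (by fun_prop), h,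
    Measure.infinitePi_map_piCurry (fun i j => μ.map (X i j))]
  congr 1
  funext i
  exact ((iIndepFun_iff_map_fun_eq_infinitePi_map (hX i)).1 (h2 i)).symm

/-- By Hölder, a product is in `L^p` once both factors are in `L^(2p)`. The exponent doubles at each
factor, so all finite exponents are carried through the induction. -/
theorem memLp_prod_of_forall_memLp {ι : Type*} (s : Finset ι) {f : ι → Ω → ℝ}
    [IsFiniteMeasure μ] (hf : ∀ i ∈ s, ∀ p : ℝ≥0∞, p ≠ ∞ → MemLp (f i) p μ) :
    ∀ p : ℝ≥0∞, p ≠ ∞ → MemLp (fun ω => ∏ i ∈ s, f i ω) p μ := by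
  classical
  induction s using Finset.induction_on with
  | empty => intro p _; simpa using memLp_const (1 : ℝ)
  | insert i s hi ih =>
    intro p hp
    have hp2 : p * 2 ≠ ∞ := ENNReal.mul_ne_top hp (by simp)
    have : ENNReal.HolderTriple (p * 2) (p * 2) p := ⟨by
      rw [ENNReal.mul_inv (by simp) (by simp), ← div_eq_mul_inv, ENNReal.add_halves]⟩
    simp only [Finset.prod_insert hi]
    exact MemLp.mul' (ih (fun j hj => hf j (Finset.mem_insert_of_mem hj)) _ hp2)
      (hf i (Finset.mem_insert_self _ _) _ hp2)

theorem psi2_le_of_ae_abs_le [IsProbabilityMeasure μ] {X : Ω → ℝ} {C : ℝ}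
    (h : ∀ᵐ ω ∂μ, |X ω| ≤ C) : psi2 μ X ≤ ENNReal.ofReal C := by
  refine iSup₂_le fun p hp => ?_
  have h1 : eLpNorm X (ENNReal.ofReal p) μ ≤ ENNReal.ofReal C := by
    simpa using eLpNorm_le_of_ae_bound (p := ENNReal.ofReal p) (μ := μ) h
  have h2 : 1 ≤ ENNReal.ofReal √p := by
    rw [ENNReal.one_le_ofReal]
    exact Real.one_le_sqrt.2 hp
  exact (ENNReal.div_le_div h1 h2).trans (by simp)

theorem psi2_sum_mul_le {n : ℕ} {X : Ω → Fin n → ℝ} {K : ℝ}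
    (h : psi2Vec μ X ≤ ENNReal.ofReal K) (y : EuclideanSpace ℝ (Fin n)) :
    psi2 μ (fun ω => ∑ j, X ω j * y j) ≤ ENNReal.ofReal (‖y‖ * K) := by
  rcases eq_or_ne y 0 with rfl | hy
  · simp [psi2]
  have hy' : ‖y‖ ≠ 0 := norm_ne_zero_iff.2 hy
  have h1 : ‖(‖y‖⁻¹ : ℝ) • y‖ = 1 := by
    rw [norm_smul, norm_inv, norm_norm, inv_mul_cancel₀ hy']
  have h2 := (le_iSup₂_of_le (f := fun (x : EuclideanSpace ℝ (Fin n)) (_ : ‖x‖ = 1) =>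
    psi2 μ (fun ω => ∑ j, X ω j * x j)) _ h1 le_rfl).trans h
  have h3 : (fun ω => ∑ j, X ω j * y j)
      = ‖y‖ • (fun ω => ∑ j, X ω j * ((‖y‖⁻¹ : ℝ) • y) j) := by
    funext ω
    simp only [Pi.smul_apply, smul_eq_mul, Finset.mul_sum, PiLp.smul_apply]
    refine Finset.sum_congr rfl fun j _ => ?_
    field_simp
  rw [h3]
  refine iSup₂_le fun p hp => ?_
  rw [eLpNorm_const_smul, mul_div_assoc, ENNReal.ofReal_mul (norm_nonneg _)]
  refine mul_le_mul' (by simp) ?_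
  exact (le_iSup₂_of_le (f := fun (p : ℝ) (_ : 1 ≤ p) =>
      eLpNorm (fun ω => ∑ j, X ω j * ((‖y‖⁻¹ : ℝ) • y) j) (ENNReal.ofReal p) μ /
        ENNReal.ofReal (Real.sqrt p)) p hp le_rfl).trans h2

theorem ae_abs_le_one_signedBernoulli : ∀ᵐ x ∂signedBernoulli, |x| ≤ 1 := by
  rw [signedBernoulli, ae_add_measure_iff]
  constructor <;> refine Measure.ae_smul_measure ?_ _ <;> simp [ae_dirac_eq]

/-- Finite moments, mean zero and unit variance are all that the second-moment identity and the
deviation bound use of the entry law. -/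
theorem moments_of_entry_law {ν : Measure ℝ}
    (hν : ν = signedBernoulli ∨ ν = gaussianReal 0 1) :
    (∀ p : ℝ≥0∞, p ≠ ∞ → MemLp id p ν) ∧ ∫ x, x ∂ν = 0 ∧ ∫ x, x * x ∂ν = 1 := by
  rcases hν with rfl | rfl
  · have : IsFiniteMeasure signedBernoulli := by
      rw [signedBernoulli]
      have : IsFiniteMeasure ((2⁻¹ : ℝ≥0∞) • Measure.dirac (-1 : ℝ)) :=
        Measure.smul_finite _ (by simp)
      have : IsFiniteMeasure ((2⁻¹ : ℝ≥0∞) • Measure.dirac (1 : ℝ)) :=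
        Measure.smul_finite _ (by simp)
      infer_instance
    have hint : ∀ (f : ℝ → ℝ) (a : ℝ), Integrable f ((2⁻¹ : ℝ≥0∞) • Measure.dirac a) :=
      fun f a => (integrable_dirac (by simp)).smul_measure (by simp)
    refine ⟨fun p _ => MemLp.of_bound (by fun_prop) 1 ae_abs_le_one_signedBernoulli, ?_, ?_⟩
    · rw [signedBernoulli, integral_add_measure (hint _ _) (hint _ _)]
      simp
    · rw [signedBernoulli, integral_add_measure (hint _ _) (hint _ _)]
      simp
      norm_num
  · refine ⟨fun p hp => memLp_id_gaussianReal' p hp, integral_id_gaussianReal, ?_⟩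
    have h := variance_eq_sub (μ := gaussianReal 0 1) (X := id) (memLp_id_gaussianReal' 2 (by simp))
    rw [variance_id_gaussianReal] at h
    simp only [id_eq, integral_id_gaussianReal] at h
    simpa [sq, Pi.mul_def, integral_id_gaussianReal] using h.symm

end Probability

/-! ### Rows of the randomized matrix -/

section Rows

variable {Ω : Type*} [MeasurableSpace Ω] {μ : Measure Ω} {ν : Measure ℝ}
  {d : ℕ} {M : Fin d → ℕ} {r r' : ℕ} {R : Ω → ∀ i, Matrix (Fin (M i)) (Fin r') ℝ}

theorem randB_apply (k : Fin d) (F : ∀ i, Matrix (Fin (M i)) (Fin r) ℝ)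
    (R : ∀ i, Matrix (Fin (M i)) (Fin r') ℝ) (a : Fin r') (l : Fin r) :
    randB k F R a l = ∏ i ∈ Finset.univ.erase k, ∑ j, R i j a * F i j l := by
  simp [randB, Matrix.mul_apply]

theorem IsIIDEntries.measurable_randB (hR : IsIIDEntries μ ν R) (k : Fin d)
    (F : ∀ i, Matrix (Fin (M i)) (Fin r) ℝ) (a : Fin r') (l : Fin r) :
    Measurable (fun ω => randB k F (R ω) a l) := by
  have := hR.measurable
  simp only [randB_apply]
  fun_prop

theorem IsIIDEntries.memLp_entry (hR : IsIIDEntries μ ν R)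
    (hν : ν = signedBernoulli ∨ ν = gaussianReal 0 1) (i : Fin d) (j : Fin (M i)) (a : Fin r')
    (p : ℝ≥0∞) (hp : p ≠ ∞) : MemLp (fun ω => R ω i j a) p μ := by
  have h := (moments_of_entry_law hν).1 p hp
  rw [← hR.law i j a] at h
  exact (memLp_map_measure_iff (by fun_prop) (hR.measurable i j a).aemeasurable).1 h

theorem IsIIDEntries.memLp_randB [IsProbabilityMeasure μ] (hR : IsIIDEntries μ ν R)
    (hν : ν = signedBernoulli ∨ ν = gaussianReal 0 1) (k : Fin d)
    (F : ∀ i, Matrix (Fin (M i)) (Fin r) ℝ) (a : Fin r') (l : Fin r)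
    (p : ℝ≥0∞) (hp : p ≠ ∞) : MemLp (fun ω => randB k F (R ω) a l) p μ := by
  simp only [randB_apply]
  refine memLp_prod_of_forall_memLp _ (fun i _ p hp => ?_) p hp
  exact memLp_finsetSum _ fun j _ => (hR.memLp_entry hν i j a p hp).mul_const _

theorem IsIIDEntries.integrable_randB_mul [IsProbabilityMeasure μ] (hR : IsIIDEntries μ ν R)
    (hν : ν = signedBernoulli ∨ ν = gaussianReal 0 1) (k : Fin d)
    (F : ∀ i, Matrix (Fin (M i)) (Fin r) ℝ) (a : Fin r') (l l' : Fin r) :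
    Integrable (fun ω => randB k F (R ω) a l * randB k F (R ω) a l') μ :=
  (hR.memLp_randB hν k F a l 2 (by simp)).integrable_mul (hR.memLp_randB hν k F a l' 2 (by simp))

theorem IsIIDEntries.integral_entry_mul (hR : IsIIDEntries μ ν R)
    (hν : ν = signedBernoulli ∨ ν = gaussianReal 0 1) (i : Fin d) (j j' : Fin (M i))
    (a : Fin r') : ∫ ω, R ω i j a * R ω i j' a ∂μ = if j = j' then 1 else 0 := by
  obtain ⟨-, h0, h1⟩ := moments_of_entry_law hν
  split_ifs with h
  · subst h
    rw [← hR.law i j a, integral_map (hR.measurable i j a).aemeasurable (by fun_prop)] at h1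
    exact h1
  · have hind : IndepFun (fun ω => R ω i j a) (fun ω => R ω i j' a) μ :=
      hR.indep.indepFun (i := ⟨i, (j, a)⟩) (j := ⟨i, (j', a)⟩) (by simpa using h)
    rw [hind.integral_fun_mul_eq_mul_integral (hR.measurable i j a).aestronglyMeasurable
      (hR.measurable i j' a).aestronglyMeasurable]
    rw [← hR.law i j a, integral_map (hR.measurable i j a).aemeasurable (by fun_prop)] at h0
    rw [h0, zero_mul]

theorem IsIIDEntries.integral_factor_mul (hR : IsIIDEntries μ ν R)
    (hν : ν = signedBernoulli ∨ ν = gaussianReal 0 1)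
    (F : ∀ i, Matrix (Fin (M i)) (Fin r) ℝ) (i : Fin d) (a : Fin r') (l l' : Fin r) :
    ∫ ω, (∑ j, R ω i j a * F i j l) * (∑ j, R ω i j a * F i j l') ∂μ
      = ((F i)ᵀ * F i) l l' := by
  have hint : ∀ j j', Integrable (fun ω => R ω i j a * R ω i j' a) μ := fun j j' =>
    (hR.memLp_entry hν i j a 2 (by simp)).integrable_mul (hR.memLp_entry hν i j' a 2 (by simp))
  have hexp : ∀ ω, (∑ j, R ω i j a * F i j l) * (∑ j, R ω i j a * F i j l')
      = ∑ j, ∑ j', R ω i j a * R ω i j' a * (F i j l * F i j' l') := by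
    intro ω
    rw [Finset.sum_mul_sum]
    exact Finset.sum_congr rfl fun j _ => Finset.sum_congr rfl fun j' _ => by ring
  simp only [hexp]
  rw [integral_finsetSum _ fun j _ => integrable_finsetSum _ fun j' _ => (hint j j').mul_const _]
  simp only [integral_finsetSum _ fun j' _ => (hint _ j').mul_const _, integral_mul_const,
    hR.integral_entry_mul hν]
  simp [Matrix.mul_apply]

/-- For a fixed row the blocks of entries belonging to different directions are independent, so the
expectation is a product of the Gram entries from `integral_factor_mul`. -/
theorem IsIIDEntries.integral_randB_mul [IsProbabilityMeasure μ] (hR : IsIIDEntries μ ν R)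
    (hν : ν = signedBernoulli ∨ ν = gaussianReal 0 1) (k : Fin d)
    (F : ∀ i, Matrix (Fin (M i)) (Fin r) ℝ) (a : Fin r') (l l' : Fin r) :
    ∫ ω, randB k F (R ω) a l * randB k F (R ω) a l' ∂μ = alsB k F l l' := by
  have hblock : iIndepFun (fun i ω => (fun j => R ω i j a : Fin (M i) → ℝ)) μ := by
    refine iIndepFun_curry (X := fun i j ω => R ω i j a) (fun i j => hR.measurable i j a) ?_
    refine hR.indep.precomp
      (g := fun p : (i : Fin d) × Fin (M i) => (⟨p.1, (p.2, a)⟩ : Σ i, Fin (M i) × Fin r')) ?_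
    rintro ⟨i, j⟩ ⟨i', j'⟩ h
    simp only [Sigma.mk.injEq] at h
    obtain ⟨rfl, h⟩ := h
    simpa using h
  have hm : ∀ i, Measurable (fun ω => (fun j => R ω i j a : Fin (M i) → ℝ)) := fun i =>
    measurable_pi_iff.2 fun j => hR.measurable i j a
  -- Direction `k` is filled with the constant factor 1, so that the product runs over the whole
  -- index type of the independent family.
  have herase : ∀ g : Fin d → ℝ,
      ∏ i ∈ Finset.univ.erase k, g i = ∏ i, if i = k then 1 else g i := by
    intro g
    rw [← Finset.mul_prod_erase Finset.univ (fun i => if i = k then 1 else g i) (Finset.mem_univ k)]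
    simp only [if_true, one_mul]
    exact Finset.prod_congr rfl fun i hi => by rw [if_neg (Finset.ne_of_mem_erase hi)]
  have h := hblock.integral_fun_prod_comp (fun i => (hm i).aemeasurable)
    (f := fun i m => if i = k then 1 else (∑ j, m j * F i j l) * (∑ j, m j * F i j l'))
    (fun i => by
      apply Measurable.aestronglyMeasurable
      split_ifs <;> fun_prop)
  simp only [randB_apply, ← Finset.prod_mul_distrib]
  simp only [herase, alsB]
  refine h.trans ?_
  refine Finset.prod_congr rfl fun i _ => ?_
  split_ifs with hi
  · simp
  · exact hR.integral_factor_mul hν F i a l l'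

/-- Row `a` depends only on the `a`-th columns of the matrices `R i`, and these blocks are disjoint
for different `a`. -/
theorem IsIIDEntries.iIndepFun_rows (hR : IsIIDEntries μ ν R) (k : Fin d)
    (F : ∀ i, Matrix (Fin (M i)) (Fin r) ℝ) (x : Fin r → ℝ) :
    iIndepFun (fun a ω => ∑ l, randB k F (R ω) a l * x l) μ := by
  have hblock : iIndepFun (fun (a : Fin r') ω => (fun q : Σ i, Fin (M i) => R ω q.1 q.2 a)) μ := by
    refine iIndepFun_curry (X := fun a (q : Σ i, Fin (M i)) ω => R ω q.1 q.2 a)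
      (fun a q => hR.measurable q.1 q.2 a) ?_
    refine hR.indep.precomp
      (g := fun p : (_ : Fin r') × (Σ i, Fin (M i)) =>
        (⟨p.2.1, (p.2.2, p.1)⟩ : Σ i, Fin (M i) × Fin r')) ?_
    rintro ⟨a, i, j⟩ ⟨a', i', j'⟩ h
    simp only [Sigma.mk.injEq] at h
    obtain ⟨rfl, h⟩ := h
    simp only [heq_eq_eq, Prod.mk.injEq] at h
    obtain ⟨rfl, rfl⟩ := h
    rfl
  have h := hblock.comp (fun _ (m : (Σ i, Fin (M i)) → ℝ) =>
    ∑ l, (∏ i ∈ Finset.univ.erase k, ∑ j, m ⟨i, j⟩ * F i j l) * x l) (fun _ => by fun_prop)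
  simpa only [randB_apply, Function.comp_def] using h

theorem IsIIDEntries.rowPsi2_ne_top [IsProbabilityMeasure μ]
    (hR : IsIIDEntries μ signedBernoulli R) (k : Fin d)
    (F : ∀ i, Matrix (Fin (M i)) (Fin r) ℝ) :
    rowPsi2 μ (fun ω => randB k F (R ω)) ≠ ∞ := by
  have hentry : ∀ᵐ ω ∂μ, ∀ i (j : Fin (M i)) a, |R ω i j a| ≤ 1 := by
    simp only [ae_all_iff]
    intro i j a
    have h := ae_abs_le_one_signedBernoulli
    rw [← hR.law i j a] at h
    exact ae_of_ae_map (hR.measurable i j a).aemeasurable h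
  refine ne_top_of_le_ne_top (b := ENNReal.ofReal
    (∑ l, ∏ i ∈ Finset.univ.erase k, ∑ j, |F i j l|)) ENNReal.ofReal_ne_top ?_
  refine iSup_le fun a => iSup₂_le fun x hx => psi2_le_of_ae_abs_le ?_
  filter_upwards [hentry] with ω hω
  refine (Finset.abs_sum_le_sum_abs _ _).trans (Finset.sum_le_sum fun l _ => ?_)
  have hxl : |x l| ≤ 1 := by simpa [hx] using PiLp.norm_apply_le x l
  rw [abs_mul, randB_apply, Finset.abs_prod]
  refine (mul_le_of_le_one_right (Finset.prod_nonneg fun _ _ => abs_nonneg _) hxl).trans ?_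
  refine Finset.prod_le_prod (fun _ _ => abs_nonneg _) fun i _ => ?_
  refine (Finset.abs_sum_le_sum_abs _ _).trans (Finset.sum_le_sum fun j _ => ?_)
  rw [abs_mul]
  exact mul_le_of_le_one_left (abs_nonneg _) (hω i j a)

end Rows

/-! ### Whitening by the square root of the ALS matrix -/

section
open scoped MatrixOrder Matrix.Norms.L2Operator

theorem psdSqrt_mul_self {n : ℕ} {A : Matrix (Fin n) (Fin n) ℝ} (hA : A.PosDef) :
    psdSqrt A * psdSqrt A = A :=
  CFC.sqrt_mul_sqrt_self A hA.posSemidef.nonneg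

theorem transpose_psdSqrt {n : ℕ} (A : Matrix (Fin n) (Fin n) ℝ) :
    (psdSqrt A)ᵀ = psdSqrt A := by
  have h : (psdSqrt A).PosSemidef := Matrix.nonneg_iff_posSemidef.1 (CFC.sqrt_nonneg A)
  simpa using h.1.eq

theorem isUnit_det_psdSqrt {n : ℕ} {A : Matrix (Fin n) (Fin n) ℝ} (hA : A.PosDef) :
    IsUnit (psdSqrt A).det := by
  have h : (psdSqrt A).det * (psdSqrt A).det = A.det := by
    rw [← Matrix.det_mul, psdSqrt_mul_self hA]
  have hpos := hA.det_pos
  rw [isUnit_iff_ne_zero]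
  intro h0
  rw [h0] at h
  simp at h
  exact hpos.ne h

theorem norm_toEuclideanLin_le_specNorm {n : ℕ} (A : Matrix (Fin n) (Fin n) ℝ)
    (y : EuclideanSpace ℝ (Fin n)) : ‖Matrix.toEuclideanLin A y‖ ≤ specNorm A * ‖y‖ :=
  Matrix.l2_opNorm_mulVec A y

end

theorem toEuclideanLin_mul_apply {l m n : ℕ} (A : Matrix (Fin l) (Fin m) ℝ)
    (B : Matrix (Fin m) (Fin n) ℝ) (v : EuclideanSpace ℝ (Fin n)) :
    Matrix.toEuclideanLin A (Matrix.toEuclideanLin B v) = Matrix.toEuclideanLin (A * B) v := by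
  simp [Matrix.toLpLin_apply, Matrix.mulVec_mulVec]

theorem toEuclideanLin_one_apply {n : ℕ} (v : EuclideanSpace ℝ (Fin n)) :
    Matrix.toEuclideanLin (1 : Matrix (Fin n) (Fin n) ℝ) v = v := by
  simp

theorem sq_norm_toEuclideanLin {m n : ℕ} (A : Matrix (Fin m) (Fin n) ℝ)
    (v : EuclideanSpace ℝ (Fin n)) :
    ‖Matrix.toEuclideanLin A v‖ ^ 2 = ∑ a, (∑ l, A a l * v l) ^ 2 := by
  rw [EuclideanSpace.real_norm_sq_eq]
  simp [Matrix.toLpLin_apply, Matrix.mulVec, dotProduct]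

theorem sq_norm_toEuclideanLin_eq_sum_transpose_mul {m n : ℕ} (A : Matrix (Fin m) (Fin n) ℝ)
    (v : EuclideanSpace ℝ (Fin n)) :
    ‖Matrix.toEuclideanLin A v‖ ^ 2 = ∑ l, ∑ l', v l * v l' * (Aᵀ * A) l l' := by
  rw [sq_norm_toEuclideanLin]
  have hexp : ∀ a, (∑ l, A a l * v l) ^ 2 = ∑ l, ∑ l', v l * v l' * (A a l * A a l') := by
    intro a
    rw [sq, Finset.sum_mul_sum]
    exact Finset.sum_congr rfl fun l _ => Finset.sum_congr rfl fun l' _ => by ring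
  simp only [hexp, Matrix.mul_apply, Matrix.transpose_apply, Finset.mul_sum]
  rw [Finset.sum_comm]
  refine Finset.sum_congr rfl fun l _ => ?_
  rw [Finset.sum_comm]

/-! ### The constants of the deviation inequality -/

/-- The parameter `s` with `E exp (s Z²) ≤ 2` for variables `Z` of sub-Gaussian norm at most
`max (K L) 1`. -/
noncomputable def expParam (K L : ℝ) : ℝ := 1 / (4 * Real.exp 1 * max (K * L) 1 ^ 2)

/-- The rate in the deviation inequality. -/
noncomputable def rateConst (K L : ℝ) : ℝ :=
  expParam K L ^ 2 / (64 * Real.exp (expParam K L)) / 1024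

/-- The dimensional constant in the deviation inequality. -/
noncomputable def dimConst (K L : ℝ) : ℝ := √(Real.log 5 / rateConst K L)

theorem expParam_pos (K L : ℝ) : 0 < expParam K L := by
  have : 0 < max (K * L) 1 := lt_max_of_lt_right one_pos
  unfold expParam
  positivity

theorem rateConst_pos (K L : ℝ) : 0 < rateConst K L := by
  have := expParam_pos K L
  unfold rateConst
  positivity

theorem dimConst_pos (K L : ℝ) : 0 < dimConst K L :=
  Real.sqrt_pos.2 (div_pos (Real.log_pos (by norm_num)) (rateConst_pos K L))

/-- With this identity `exp (-c C² r) = 5 ^ (-r)`, which cancels the cardinality of the net. -/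
theorem rateConst_mul_sq_dimConst (K L : ℝ) : rateConst K L * dimConst K L ^ 2 = Real.log 5 := by
  have h := rateConst_pos K L
  rw [dimConst, Real.sq_sqrt (div_nonneg (Real.log_nonneg (by norm_num)) h.le)]
  field_simp

/-! ### Deviation inequality -/

section Deviation

variable {Ω : Type*} [MeasurableSpace Ω] {μ : Measure Ω} [IsProbabilityMeasure μ] {ν : Measure ℝ}
  {d : ℕ} {M : Fin d → ℕ} {r r' : ℕ} {R : Ω → ∀ i, Matrix (Fin (M i)) (Fin r') ℝ}

theorem IsIIDEntries.integral_sq_row (hR : IsIIDEntries μ ν R)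
    (hν : ν = signedBernoulli ∨ ν = gaussianReal 0 1) (k : Fin d)
    (F : ∀ i, Matrix (Fin (M i)) (Fin r) ℝ) (a : Fin r') (x : EuclideanSpace ℝ (Fin r)) :
    Integrable (fun ω => (∑ l, randB k F (R ω) a l * x l) ^ 2) μ ∧
      ∫ ω, (∑ l, randB k F (R ω) a l * x l) ^ 2 ∂μ
        = ∑ l, ∑ l', x l * x l' * alsB k F l l' := by
  have hexp : ∀ ω, (∑ l, randB k F (R ω) a l * x l) ^ 2
      = ∑ l, ∑ l', x l * x l' * (randB k F (R ω) a l * randB k F (R ω) a l') := by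
    intro ω
    rw [sq, Finset.sum_mul_sum]
    exact Finset.sum_congr rfl fun l _ => Finset.sum_congr rfl fun l' _ => by ring
  have hint := fun l l' => (hR.integrable_randB_mul hν k F a l l').const_mul (x l * x l')
  simp only [hexp]
  refine ⟨integrable_finsetSum _ fun l _ => integrable_finsetSum _ fun l' _ => hint l l', ?_⟩
  rw [integral_finsetSum _ fun l _ => integrable_finsetSum _ fun l' _ => hint l l']
  simp only [integral_finsetSum _ fun l' _ => hint _ l', integral_const_mul,
    hR.integral_randB_mul hν]

/-- Concentration of the squared norm of the image of a fixed whitened unit vector. -/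
theorem IsIIDEntries.measure_abs_sq_norm_sub_ge_le (hR : IsIIDEntries μ ν R)
    (hν : ν = signedBernoulli ∨ ν = gaussianReal 0 1) (hr' : 0 < r') (k : Fin d)
    (F : ∀ i, Matrix (Fin (M i)) (Fin r) ℝ) (hpd : (alsB k F).PosDef)
    (htop : rowPsi2 μ (fun ω => randB k F (R ω)) ≠ ∞) {K L : ℝ}
    (hK : K = (rowPsi2 μ (fun ω => randB k F (R ω))).toReal)
    (hL : L = specNorm (psdSqrt (alsB k F))⁻¹) {y : EuclideanSpace ℝ (Fin r)} (hy : ‖y‖ = 1)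
    {ε : ℝ} (hε0 : 0 ≤ ε) (hε1 : ε ≤ 1) :
    μ.real {ω | ε ≤ |(r' : ℝ)⁻¹ * ‖Matrix.toEuclideanLin (randB k F (R ω))
        (Matrix.toEuclideanLin (psdSqrt (alsB k F))⁻¹ y)‖ ^ 2 - 1|}
      ≤ 2 * Real.exp (-(1024 * rateConst K L) * (r' * ε ^ 2)) := by
  set S := psdSqrt (alsB k F) with hS
  set x := Matrix.toEuclideanLin S⁻¹ y with hx
  have hSx : Matrix.toEuclideanLin S x = y := by
    rw [hx, toEuclideanLin_mul_apply, Matrix.mul_nonsing_inv _ (isUnit_det_psdSqrt hpd),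
      toEuclideanLin_one_apply]
  -- The left side is the second moment of every row paired with `x`, and it equals `‖S x‖² = ‖y‖²`.
  have hone : ∑ l, ∑ l', x l * x l' * alsB k F l l' = 1 := by
    have h := sq_norm_toEuclideanLin_eq_sum_transpose_mul S x
    rw [hSx, hy, hS, transpose_psdSqrt, psdSqrt_mul_self hpd] at h
    rw [← h]; norm_num
  have hK0 : 0 ≤ K := hK ▸ ENNReal.toReal_nonneg
  have hmax : 0 < max (K * L) 1 := lt_max_of_lt_right one_pos
  -- Here `‖x‖ ≤ L`, so the norm is at most `K L`. The maximum with 1 supplies the strict positivity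
  -- that the exponential moment bound needs.
  have hpsi : ∀ a, psi2 μ (fun ω => ∑ l, randB k F (R ω) a l * x l)
      ≤ ENNReal.ofReal (max (K * L) 1) := by
    intro a
    have h1 : psi2Vec μ (fun ω => randB k F (R ω) a) ≤ ENNReal.ofReal K := by
      rw [hK, ENNReal.ofReal_toReal htop]
      exact le_iSup (fun a => psi2Vec μ (fun ω => randB k F (R ω) a)) a
    refine (psi2_sum_mul_le h1 x).trans (ENNReal.ofReal_le_ofReal ((le_max_left _ _).trans' ?_))
    have h2 := norm_toEuclideanLin_le_specNorm S⁻¹ y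
    rw [hy, mul_one, ← hL] at h2
    rw [mul_comm K]
    gcongr
  have hm : ∀ a, Measurable (fun ω => ∑ l, randB k F (R ω) a l * x l) := fun a =>
    Finset.measurable_sum _ fun l _ => (hR.measurable_randB k F a l).mul_const _
  have h := measure_abs_sum_sq_sub_ge_le hr' hm (hR.iIndepFun_rows k F x) (expParam_pos K L)
    (fun a => lintegral_exp_mul_sq_le_two (hm a) hmax (hpsi a))
    (fun a => (hR.integral_sq_row hν k F a x).1)
    (fun a => (hR.integral_sq_row hν k F a x).2.trans hone) hε0 hε1
  simp only [sq_norm_toEuclideanLin]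
  refine h.trans (le_of_eq ?_)
  rw [rateConst]
  congr 3
  ring

theorem IsIIDEntries.one_sub_le_measure_rank_cond (hR : IsIIDEntries μ ν R)
    (hν : ν = signedBernoulli ∨ ν = gaussianReal 0 1) (hr' : 0 < r') (k : Fin d)
    (F : ∀ i, Matrix (Fin (M i)) (Fin r) ℝ) (hpd : (alsB k F).PosDef)
    (htop : rowPsi2 μ (fun ω => randB k F (R ω)) ≠ ∞) {K L : ℝ}
    (hK : K = (rowPsi2 μ (fun ω => randB k F (R ω))).toReal)
    (hL : L = specNorm (psdSqrt (alsB k F))⁻¹) {t : ℝ} (ht : 0 ≤ t)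
    (hδ1 : dimConst K L * √((r : ℝ) / r') + t / √(r' : ℝ) < 1) :
    1 - 2 * Real.exp (-(rateConst K L * t ^ 2)) ≤
      μ.real {ω | (randB k F (R ω)).rank = r ∧
        cond (randB k F (R ω)) ≤
          (1 + dimConst K L * √((r : ℝ) / r') + t / √(r' : ℝ)) /
            (1 - dimConst K L * √((r : ℝ) / r') - t / √(r' : ℝ)) *
          cond (psdSqrt (alsB k F))} := by
  have hC := dimConst_pos K L
  have hc := rateConst_pos K L
  have hr0 : (0 : ℝ) < r' := by exact_mod_cast hr'
  set C := dimConst K L with hCdef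
  set δ := C * √((r : ℝ) / r') + t / √(r' : ℝ) with hδ
  have hδ0 : 0 ≤ δ := by positivity
  set S := psdSqrt (alsB k F) with hS
  obtain ⟨net, hnet1, hcard, hcov⟩ := exists_half_net_unitSphere (EuclideanSpace ℝ (Fin r))
  rw [finrank_euclideanSpace_fin] at hcard
  set bad : EuclideanSpace ℝ (Fin r) → Set Ω := fun y =>
    {ω | δ / 32 ≤ |(r' : ℝ)⁻¹ * ‖Matrix.toEuclideanLin (randB k F (R ω))
        (Matrix.toEuclideanLin S⁻¹ y)‖ ^ 2 - 1|} with hbad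
  have hbad_meas : ∀ y, MeasurableSet (bad y) := by
    intro y
    have hm := hR.measurable_randB k F
    simp only [hbad, sq_norm_toEuclideanLin]
    refine measurableSet_le measurable_const ?_
    have : Measurable fun ω => (r' : ℝ)⁻¹ * ∑ a, (∑ l, randB k F (R ω) a l *
        (Matrix.toEuclideanLin S⁻¹ y) l) ^ 2 - 1 :=
      ((Finset.measurable_sum _ fun a _ => (Finset.measurable_sum _ fun l _ =>
        (hm a l).mul_const _).pow_const 2).const_mul _).sub_const 1
    exact this.abs
  -- Measurability is needed only for this union, to take its complement; the rank and condition
  -- number event enters by monotonicity alone.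
  have hUm : MeasurableSet (⋃ y ∈ net, bad y) := net.measurableSet_biUnion fun y _ => hbad_meas y
  have hgood : (⋃ y ∈ net, bad y)ᶜ ⊆ {ω | (randB k F (R ω)).rank = r ∧
        cond (randB k F (R ω)) ≤
          (1 + C * √((r : ℝ) / r') + t / √(r' : ℝ)) /
            (1 - C * √((r : ℝ) / r') - t / √(r' : ℝ)) * cond S} := by
    intro ω hω
    have hSinv : ∀ v, Matrix.toEuclideanLin S⁻¹ (Matrix.toEuclideanLin S v) = v := fun v => by
      rw [toEuclideanLin_mul_apply, Matrix.nonsing_inv_mul _ (isUnit_det_psdSqrt hpd),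
        toEuclideanLin_one_apply]
    have hη : ∀ y ∈ (net : Set (EuclideanSpace ℝ (Fin r))),
        |(r' : ℝ)⁻¹ * ‖(Matrix.toEuclideanLin (randB k F (R ω)) ∘ₗ
          Matrix.toEuclideanLin S⁻¹) y‖ ^ 2 - 1| ≤ δ / 32 := by
      intro y hy
      by_contra! hlt
      exact hω (Set.mem_biUnion hy hlt.le)
    have hall := abs_sq_norm_sub_le_of_net _ _ _ (net : Set (EuclideanSpace ℝ (Fin r))) hnet1
      hcov hη
    have h := rank_and_cond_le_of_abs_le (randB k F (R ω)) S
      (Function.LeftInverse.injective hSinv) (inv_pos.2 hr0) hδ0 hδ1 (fun v => by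
        have := hall (Matrix.toEuclideanLin S v)
        rwa [LinearMap.comp_apply, hSinv, mul_div_cancel₀ _ (by norm_num : (32 : ℝ) ≠ 0)] at this)
    rw [hδ, ← add_assoc, ← sub_sub] at h
    exact h
  have hprob : μ.real (⋃ y ∈ net, bad y) ≤ 2 * Real.exp (-(rateConst K L * t ^ 2)) := by
    -- The right side is `(C √r + t)²`; the nonnegative cross term is dropped.
    have hδN : C ^ 2 * r + t ^ 2 ≤ r' * δ ^ 2 := by
      have h1 : r' * δ ^ 2 = (C * √(r : ℝ) + t) ^ 2 := by
        rw [hδ, Real.sqrt_div (by positivity), ← mul_div_assoc, ← add_div, div_pow,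
          Real.sq_sqrt hr0.le]
        field_simp
      have h2 : √(r : ℝ) ^ 2 = r := Real.sq_sqrt (by positivity)
      have h3 : 0 ≤ C * √(r : ℝ) * t := by positivity
      rw [h1, add_sq, mul_pow, h2]
      linarith
    -- `1024 = 32²` offsets the tolerance `δ / 32` required on the net, and `c C² = log 5` turns the
    -- dimensional part into `r log 5`.
    have hexp : -(1024 * rateConst K L) * (r' * (δ / 32) ^ 2)
        ≤ -(r * Real.log 5) + -(rateConst K L * t ^ 2) := by
      rw [← rateConst_mul_sq_dimConst K L, ← hCdef]
      nlinarith
    calc μ.real (⋃ y ∈ net, bad y) ≤ ∑ y ∈ net, μ.real (bad y) :=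
          measureReal_biUnion_finset_le _ _
      _ ≤ ∑ _y ∈ net, 2 * Real.exp (-(r * Real.log 5) + -(rateConst K L * t ^ 2)) := by
          refine Finset.sum_le_sum fun y hy => ?_
          refine (hR.measure_abs_sq_norm_sub_ge_le hν hr' k F hpd htop hK hL (hnet1 y hy)
            (by positivity) (by linarith)).trans ?_
          gcongr
      _ = net.card * (2 * Real.exp (-(r * Real.log 5) + -(rateConst K L * t ^ 2))) := by
          rw [Finset.sum_const, nsmul_eq_mul]
      _ ≤ 5 ^ r * (2 * Real.exp (-(r * Real.log 5) + -(rateConst K L * t ^ 2))) := by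
          gcongr
          exact_mod_cast hcard
      _ = 2 * Real.exp (-(rateConst K L * t ^ 2)) := by
          rw [Real.exp_add, Real.exp_neg (r * Real.log 5), Real.exp_nat_mul,
            Real.exp_log (by norm_num)]
          field_simp
  have hcompl : μ.real (⋃ y ∈ net, bad y)ᶜ = 1 - μ.real (⋃ y ∈ net, bad y) :=
    probReal_compl_eq_one_sub hUm
  calc _ ≤ μ.real (⋃ y ∈ net, bad y)ᶜ := by linarith
    _ ≤ _ := measureReal_mono hgood

end Deviation

end RandALS

/-! ### The main theorem -/

theorem mainTheorem3 :
    ∃ C c : ℝ → ℝ → ℝ, (∀ K L : ℝ, 0 < C K L ∧ 0 < c K L) ∧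
      ∀ {Ω : Type*} [MeasurableSpace Ω] (μ : Measure Ω) [IsProbabilityMeasure μ]
        (ν : Measure ℝ) (_ : ν = RandALS.signedBernoulli ∨ ν = gaussianReal 0 1)
        (d : ℕ) (k : Fin d) (M : Fin d → ℕ) (r r' : ℕ) (_ : 0 < r')
        (F : ∀ i, Matrix (Fin (M i)) (Fin r) ℝ)
        (R : Ω → ∀ i, Matrix (Fin (M i)) (Fin r') ℝ) (_ : RandALS.IsIIDEntries μ ν R),
        -- every row of the randomized matrix has second-moment matrix equal to the ALS matrix
        (∀ (a : Fin r') (l l' : Fin r),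
          Integrable
            (fun ω => RandALS.randB k F (R ω) a l * RandALS.randB k F (R ω) a l') μ ∧
          ∫ ω, RandALS.randB k F (R ω) a l * RandALS.randB k F (R ω) a l' ∂μ
            = RandALS.alsB k F l l') ∧
        -- in the signed Bernoulli case the rows are sub-Gaussian
        (ν = RandALS.signedBernoulli →
          RandALS.rowPsi2 μ (fun ω => RandALS.randB k F (R ω)) ≠ ∞) ∧
        -- condition number bound, whenever the rows are sub-Gaussian
        ((RandALS.alsB k F).PosDef →
          RandALS.rowPsi2 μ (fun ω => RandALS.randB k F (R ω)) ≠ ∞ →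
          ∀ K L : ℝ,
            K = (RandALS.rowPsi2 μ (fun ω => RandALS.randB k F (R ω))).toReal →
            L = RandALS.specNorm (RandALS.psdSqrt (RandALS.alsB k F))⁻¹ →
            ∀ t : ℝ, 0 ≤ t → C K L * √((r : ℝ) / r') + t / √(r' : ℝ) < 1 →
              1 - 2 * Real.exp (-(c K L * t ^ 2)) ≤
                μ.real {ω | (RandALS.randB k F (R ω)).rank = r ∧
                  RandALS.cond (RandALS.randB k F (R ω)) ≤
                    (1 + C K L * √((r : ℝ) / r') + t / √(r' : ℝ)) /
                      (1 - C K L * √((r : ℝ) / r') - t / √(r' : ℝ)) *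
                    RandALS.cond (RandALS.psdSqrt (RandALS.alsB k F))}) := by
  refine ⟨RandALS.dimConst, RandALS.rateConst,
    fun K L => ⟨RandALS.dimConst_pos K L, RandALS.rateConst_pos K L⟩, ?_⟩
  intro Ω _ μ _ ν hν d k M r r' hr' F R hR
  refine ⟨fun a l l' => ⟨hR.integrable_randB_mul hν k F a l l', hR.integral_randB_mul hν k F a l l'⟩,
    ?_, ?_⟩
  · rintro rfl
    exact hR.rowPsi2_ne_top k F
  · intro hpd htop K L hK hL t ht hδ
    exact hR.one_sub_le_measure_rank_cond hν hr' k F hpd htop hK hL ht hδ
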